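/- Let $(L,o)$ be an oriented link in the thickened annulus $A\times I$, given by a diagram $\mathcal P(L)\subset A\subset S^2-\{\mathbb O,\mathbb X\}$, where $\mathbb X$ and $\mathbb O$ are basepoints at the inner and outer boundary circles of $A$; let $\overline o$ be the opposite orientation of all components. Let $(\mathcal C,\partial^{Lee})$ be the Lee complex over $\mathbb C$ of $\mathcal P(L)$, regarded as a diagram in $\mathbb R^2=S^2-\{\mathbb O\}$. It has a distinguished basis: the complete resolutions of $\mathcal P(L)$ with every circle marked $v_+$ or $v_-$. Each basis element has a quantum grading $j$ (depending on $o$ only through the numbers of positive and negative crossings) and an annular grading $k$, which is the number of circles marked $v_+$ minus the number of circles marked $v_-$, counting only the circles that separate $\mathbb X$ from $\mathbb O$. For $t\in[0,2]$ put $j_t=j-t\,k$, and let $\mathcal F_a\subset\mathcal C$ be the span of the basis elements with $j_t\ge a$. For a nonzero chain $x$ let $\mathrm{gr}_{j_t}(x)=\max\{a : x\in\mathcal F_a\}$, and for a nonzero class $\eta\in H_*(\mathcal C,\partial^{Lee})$ let $\mathrm{gr}_{j_t}(\eta)=\max\{\mathrm{gr}_{j_t}(x) : x \text{ a cycle with }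 [x]=\eta\}$. Let $\mathfrak s_o$ be Lee's canonical cycle: the oriented resolution of $(\mathcal P(L),o)$ in which a circle is labelled by $\mathbf a=v_-+v_+$ or $\mathbf b=v_--v_+$ according to whether the number of circles separating it from $\mathbb O$, plus $1$ if it is oriented counterclockwise, is even or odd. Put $d_t(L,o)=\mathrm{gr}_{j_t}([\mathfrak s_o])$. Then, for every $t\in[0,2]$, the classes $[\mathfrak s_o]$ and $[\mathfrak s_{\overline o}]$ are nonzero and $$d_t(L,o)=d_t(L,\overline o)=\min\{\mathrm{gr}_{j_t}(\eta) : \eta\in\mathrm{Span}_{\mathbb C}\{[\mathfrak s_o],[\mathfrak s_{\overline o}]\},\ \eta\ne 0\}.$$ -/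

import Mathlib

/-!
# Annular link diagrams and their Lee complexes

The annulus is drawn in the plane with polar coordinates, with the basepoint `X` at the centre and
the basepoint `O` at infinity.  A generic diagram of an annular link is cut by finitely many radial
arcs into sectors, each of which contains at most one crossing or one extremum of the
angular coordinate.  On every radial arc the strands are numbered `0, 1, 2, ...` starting from the
outer end (the end nearest to `O`).  Sectors are traversed counterclockwise.
-/

/-- What happens in one sector, from its first (incoming) radial arc to its second (outgoing) one.
In `cross q pos` the strands `q` and `q + 1` cross; `pos` tells whether the crossing is positive
when both strands are oriented counterclockwise around `X`.  In `birth q` two new strands `q` and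
`q + 1` appear, joined to one another; in `death q` the strands `q` and `q + 1` are joined and
disappear; `turnback q` is `death q` followed by `birth q`. -/
inductive AnnularPiece where
  | straight
  | cross (q : ℕ) (pos : Bool)
  | turnback (q : ℕ)
  | birth (q : ℕ)
  | death (q : ℕ)

namespace AnnularPiece

/-- The piece can be drawn between `m` incoming and `n` outgoing strands. -/
def Fits : AnnularPiece → ℕ → ℕ → Prop
  | straight, m, n => n = m
  | cross q _, m, n => q + 1 < m ∧ n = m
  | turnback q, m, n => q + 1 < m ∧ n = m
  | birth q, m, n => q ≤ m ∧ n = m + 2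
  | death q, m, n => q ≤ n ∧ m = n + 2

/-- The incoming strand `p` runs through the sector and leaves it as the outgoing strand `p'`. -/
def Through : AnnularPiece → ℕ → ℕ → Prop
  | straight, p, p' => p' = p
  | cross q _, p, p' =>
      (p = q ∧ p' = q + 1) ∨ (p = q + 1 ∧ p' = q) ∨ (p ≠ q ∧ p ≠ q + 1 ∧ p' = p)
  | turnback q, p, p' => p ≠ q ∧ p ≠ q + 1 ∧ p' = p
  | birth q, p, p' => (p < q ∧ p' = p) ∨ (q ≤ p ∧ p' = p + 2)
  | death q, p, p' => (p' < q ∧ p = p') ∨ (q ≤ p' ∧ p = p' + 2)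

/-- The incoming strands `p` and `p'` are joined to one another in the sector. -/
def TurnsIn : AnnularPiece → ℕ → ℕ → Prop
  | turnback q, p, p' => p = q ∧ p' = q + 1
  | death q, p, p' => p = q ∧ p' = q + 1
  | _, _, _ => False

/-- The outgoing strands `p` and `p'` are joined to one another in the sector. -/
def TurnsOut : AnnularPiece → ℕ → ℕ → Prop
  | turnback q, p, p' => p = q ∧ p' = q + 1
  | birth q, p, p' => p = q ∧ p' = q + 1
  | _, _, _ => False

def IsCrossing : AnnularPiece → Prop
  | cross _ _ => True
  | _ => False

/-- The number `q` of the outer one of the two strands that meet at a crossing. -/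
def index : AnnularPiece → ℕ
  | cross q _ => q
  | _ => 0

/-- The flag `pos` of a crossing. -/
def handed : AnnularPiece → Bool
  | cross _ pos => pos
  | _ => false

/-- The `0`-smoothing (`b = false`) or `1`-smoothing (`b = true`) of a crossing.  The `0`-smoothing
of a positive crossing is the smoothing that respects the orientations, and so is the
`1`-smoothing of a negative crossing. -/
def smooth (b : Bool) : AnnularPiece → AnnularPiece
  | cross q pos => if b = pos then turnback q else straight
  | e => e

theorem IsCrossing.eq_cross {e : AnnularPiece} (h : e.IsCrossing) :
    e = cross e.index e.handed := by
  cases e <;> simp_all [IsCrossing, index, handed]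

theorem IsCrossing.fits {e : AnnularPiece} (h : e.IsCrossing) {m n : ℕ} (hf : e.Fits m n) :
    e.index + 1 < m ∧ n = m := by
  rw [h.eq_cross] at hf
  exact hf

theorem Through.near {e : AnnularPiece} (he : ¬ e.IsCrossing) {p p' : ℕ} (h : e.Through p p') :
    p' = p ∨ p' = p + 2 ∨ p = p' + 2 := by
  cases e <;> simp only [Through, IsCrossing, not_true_eq_false] at h he <;> omega

theorem TurnsIn.next {e : AnnularPiece} {p p' : ℕ} (h : e.TurnsIn p p') : p' = p + 1 := by
  cases e <;> simp only [TurnsIn] at h <;> omega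

theorem TurnsOut.next {e : AnnularPiece} {p p' : ℕ} (h : e.TurnsOut p p') : p' = p + 1 := by
  cases e <;> simp only [TurnsOut] at h <;> omega

end AnnularPiece

/-- A diagram of a link in the thickened annulus.  The radial arcs are numbered cyclically by
`Fin (len + 1)`; the sector `s` lies between the radial arcs `s` and `s + 1`, and the sector `len`
ends at the radial arc `0`. -/
structure AnnularDiagram where
  len : ℕ
  width : Fin (len + 1) → ℕ
  piece : Fin (len + 1) → AnnularPiece
  fits : ∀ s, (piece s).Fits (width s) (width (s + 1))

namespace AnnularDiagram

variable (D : AnnularDiagram)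

/-- The intersection points of the diagram with the radial arcs. -/
abbrev Point : Type := Σ s : Fin (D.len + 1), Fin (D.width s)

/-- The crossings of the diagram, ordered by their sectors. -/
abbrev Crossing : Type := {s : Fin (D.len + 1) // (D.piece s).IsCrossing}

/-- The incoming end of the outer strand at a crossing. -/
def inOuter (c : D.Crossing) : D.Point :=
  ⟨c.1, (D.piece c.1).index, by have := (c.2.fits (D.fits c.1)).1; omega⟩

/-- The incoming end of the inner strand at a crossing. -/
def inInner (c : D.Crossing) : D.Point :=
  ⟨c.1, (D.piece c.1).index + 1, (c.2.fits (D.fits c.1)).1⟩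

/-- The outgoing inner end at a crossing. -/
def outInner (c : D.Crossing) : D.Point :=
  ⟨c.1 + 1, (D.piece c.1).index + 1, by have := c.2.fits (D.fits c.1); omega⟩

/-! ### Orientations -/

/-- An orientation of the link: `dir a` tells whether the strand through the point `a` runs
counterclockwise around `X` there. -/
structure Orientation where
  dir : D.Point → Bool
  dir_through : ∀ s (p : Fin (D.width s)) (p' : Fin (D.width (s + 1))),
    (D.piece s).Through p p' → dir ⟨s + 1, p'⟩ = dir ⟨s, p⟩
  dir_turnsIn : ∀ s (p p' : Fin (D.width s)),
    (D.piece s).TurnsIn p p' → dir ⟨s, p'⟩ = !dir ⟨s, p⟩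
  dir_turnsOut : ∀ s (p p' : Fin (D.width (s + 1))),
    (D.piece s).TurnsOut p p' → dir ⟨s + 1, p'⟩ = !dir ⟨s + 1, p⟩

/-- The opposite orientation (of all components). -/
def Orientation.reverse {D : AnnularDiagram} (o : D.Orientation) : D.Orientation where
  dir a := !o.dir a
  dir_through s p p' h := by rw [o.dir_through s p p' h]
  dir_turnsIn s p p' h := by rw [o.dir_turnsIn s p p' h]
  dir_turnsOut s p p' h := by rw [o.dir_turnsOut s p p' h]

/-- Whether a crossing is positive: reversing one of its two strands changes the sign. -/
def Orientation.isPositive {D : AnnularDiagram} (o : D.Orientation) (c : D.Crossing) : Bool :=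
  (D.piece c.1).handed == (o.dir (D.inOuter c) == o.dir (D.inInner c))

/-- The number of positive crossings. -/
noncomputable def Orientation.nPos {D : AnnularDiagram} (o : D.Orientation) : ℕ :=
  Nat.card {c : D.Crossing // o.isPositive c = true}

/-- The number of negative crossings. -/
noncomputable def Orientation.nNeg {D : AnnularDiagram} (o : D.Orientation) : ℕ :=
  Nat.card {c : D.Crossing // o.isPositive c = false}

/-! ### The cube of resolutions -/

/-- A vertex of the cube of resolutions: the choice of a smoothing of every crossing. -/
abbrev Vertex : Type := D.Crossing → Bool

open Classical in
/-- The sectors of the complete resolution at the vertex `r`. -/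
noncomputable def resolved (r : D.Vertex) (s : Fin (D.len + 1)) : AnnularPiece :=
  (D.piece s).smooth (if h : (D.piece s).IsCrossing then r ⟨s, h⟩ else false)

/-- Two points are joined by an arc of the complete resolution at `r` inside one sector. -/
inductive Joined (r : D.Vertex) : D.Point → D.Point → Prop
  | through (s : Fin (D.len + 1)) (p : Fin (D.width s)) (p' : Fin (D.width (s + 1))) :
      (D.resolved r s).Through p p' → Joined r ⟨s, p⟩ ⟨s + 1, p'⟩
  | turnsIn (s : Fin (D.len + 1)) (p p' : Fin (D.width s)) :
      (D.resolved r s).TurnsIn p p' → Joined r ⟨s, p⟩ ⟨s, p'⟩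
  | turnsOut (s : Fin (D.len + 1)) (p p' : Fin (D.width (s + 1))) :
      (D.resolved r s).TurnsOut p p' → Joined r ⟨s + 1, p⟩ ⟨s + 1, p'⟩

/-- The circles of the complete resolution at `r`. -/
def Circle (r : D.Vertex) : Type := Quot (D.Joined r)

/-- The circle through a point. -/
def circleOf (r : D.Vertex) (a : D.Point) : D.Circle r := Quot.mk _ a

instance (r : D.Vertex) : Finite (D.Circle r) := inferInstanceAs (Finite (Quot _))

noncomputable instance (r : D.Vertex) : Fintype (D.Circle r) := Fintype.ofFinite _

noncomputable instance : Fintype D.Crossing := Fintype.ofFinite _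

open Classical in
noncomputable instance (r : D.Vertex) : DecidableEq (D.Circle r) := fun _ _ => inferInstance

/-- The distinguished generators of the complex: complete resolutions with a marking of every circle
by `v₊` (`true`) or `v₋` (`false`). -/
abbrev Generator : Type := Σ r : D.Vertex, (D.Circle r → Bool)

noncomputable instance : Fintype D.Generator := Fintype.ofFinite _

variable {D} in
/-- The marking of the circle through a point. -/
def Generator.mark (x : D.Generator) (a : D.Point) : Bool := x.2 (D.circleOf x.1 a)

/-- The vector space underlying the Lee complex, with complex coefficients. -/
abbrev Chain : Type := D.Generator → ℂ

variable {D} in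
open Classical in
/-- The distinguished basis vector that belongs to a generator. -/
noncomputable def Generator.vec (x : D.Generator) : D.Chain := Pi.single x 1

/-! ### The Lee differential -/

/-- The coefficient of `v_z` in the product of `v_x` and `v_y`:
`v₊ v₊ = v₊`, `v₊ v₋ = v₋ v₊ = v₋`, `v₋ v₋ = v₊`, the last one being Lee's term. -/
def mulCoeff : Bool → Bool → Bool → ℂ
  | true, true, true => 1
  | true, false, false => 1
  | false, true, false => 1
  | false, false, true => 1
  | _, _, _ => 0

/-- The coefficient of `v_y ⊗ v_z` in the coproduct of `v_x`:
`v₊ ↦ v₊ ⊗ v₋ + v₋ ⊗ v₊` and `v₋ ↦ v₋ ⊗ v₋ + v₊ ⊗ v₊`, the last term being Lee's. -/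
def comulCoeff : Bool → Bool → Bool → ℂ
  | true, true, false => 1
  | true, false, true => 1
  | false, false, false => 1
  | false, true, true => 1
  | _, _, _ => 0

/-- There is an edge of the cube from `r` to `r'` that changes the smoothing of `c`. -/
def IsEdge (r r' : D.Vertex) (c : D.Crossing) : Prop :=
  r c = false ∧ r' c = true ∧ ∀ c', c' ≠ c → r' c' = r c'

open Classical in
/-- The sign of an edge that changes the smoothing of `c`. -/
noncomputable def edgeSign (r : D.Vertex) (c : D.Crossing) : ℂ :=
  (-1) ^ (Finset.univ.filter fun c' : D.Crossing => c'.1 < c.1 ∧ r c' = true).card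

/-- The markings of `x` and `y` agree on all circles that are disjoint from the crossing `c`.  In
either smoothing of `c` one of the two arcs at `c` ends at `inOuter c` and the other one
at `outInner c`. -/
def AgreeAway (x y : D.Generator) (c : D.Crossing) : Prop :=
  ∀ a, D.circleOf x.1 a ≠ D.circleOf x.1 (D.inOuter c) →
    D.circleOf x.1 a ≠ D.circleOf x.1 (D.outInner c) → y.mark a = x.mark a

open Classical in
/-- The matrix entry of the merge or split map at the crossing `c`: if the two arcs at `c` lie on
different circles, then these are merged, otherwise their circle is split. -/
noncomputable def saddleCoeff (x y : D.Generator) (c : D.Crossing) : ℂ :=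
  if D.circleOf x.1 (D.inOuter c) ≠ D.circleOf x.1 (D.outInner c) then
    mulCoeff (x.mark (D.inOuter c)) (x.mark (D.outInner c)) (y.mark (D.inOuter c))
  else
    comulCoeff (x.mark (D.inOuter c)) (y.mark (D.inOuter c)) (y.mark (D.outInner c))

open Classical in
/-- The coefficient of `y` in the Lee differential of `x`. -/
noncomputable def diffCoeff (x y : D.Generator) : ℂ :=
  ∑ c : D.Crossing, if D.IsEdge x.1 y.1 c ∧ D.AgreeAway x y c then
    D.edgeSign x.1 c * D.saddleCoeff x y c else 0

/-- The Lee differential. -/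
noncomputable def leeDiff : D.Chain →ₗ[ℂ] D.Chain :=
  Matrix.mulVecLin (Matrix.of fun y x => D.diffCoeff x y)

/-- The homology of the Lee complex: cycles modulo boundaries. -/
abbrev LeeHomology : Type :=
  LinearMap.ker D.leeDiff ⧸ (LinearMap.range D.leeDiff).submoduleOf (LinearMap.ker D.leeDiff)

/-- The homology class of a cycle. -/
noncomputable def homologyClass : LinearMap.ker D.leeDiff →ₗ[ℂ] D.LeeHomology :=
  Submodule.mkQ _

/-! ### Gradings -/

/-- A circle is nontrivial if it meets the radial arc `0`, which runs from `X` to `O`, in an odd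
number of points. -/
def IsNontrivial {r : D.Vertex} (C : D.Circle r) : Prop :=
  Odd (Nat.card {p : Fin (D.width 0) // D.circleOf r ⟨0, p⟩ = C})

/-- `v₊` has degree `1` and `v₋` has degree `-1`. -/
def markDegree (b : Bool) : ℤ := if b then 1 else -1

variable {D}

/-- The quantum grading, for the orientation `o`. -/
noncomputable def Orientation.jGrading (o : D.Orientation) (x : D.Generator) : ℤ :=
  (∑ C : D.Circle x.1, markDegree (x.2 C)) + (Nat.card {c : D.Crossing // x.1 c = true} : ℤ)
    + o.nPos - 2 * o.nNeg

variable (D) in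
open Classical in
/-- The annular grading: the algebraic intersection number of the radial arc `0` with the circles,
where those marked `v₊` run counterclockwise and those marked `v₋` run clockwise. -/
noncomputable def kGrading (x : D.Generator) : ℤ :=
  ∑ C : D.Circle x.1, if D.IsNontrivial C then markDegree (x.2 C) else 0

/-- The `j_t`-grading of a distinguished generator. -/
noncomputable def Orientation.jtGrading (o : D.Orientation) (t : ℝ) (x : D.Generator) : ℝ :=
  (o.jGrading x : ℝ) - t * (D.kGrading x : ℝ)

/-- The descending filtration of the Lee complex that is induced by the `j_t`-grading. -/
noncomputable def Orientation.filtration (o : D.Orientation) (t a : ℝ) : Submodule ℂ D.Chain :=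
  Submodule.span ℂ (Generator.vec '' {x | a ≤ o.jtGrading t x})

/-- The filtration grading of a nonzero chain `z`: the largest `a` such that `z` lies in step `a`
of the filtration. -/
noncomputable def Orientation.chainGrading (o : D.Orientation) (t : ℝ) (z : D.Chain) : ℝ :=
  sSup {a : ℝ | z ∈ o.filtration t a}

/-- The `j_t`-grading of a nonzero homology class: the largest grading of a cycle that
represents it. -/
noncomputable def Orientation.homologyGrading (o : D.Orientation) (t : ℝ) (η : D.LeeHomology) : ℝ :=
  sSup {g : ℝ | ∃ z : LinearMap.ker D.leeDiff, D.homologyClass z = η ∧ o.chainGrading t z = g}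

/-! ### The canonical cycles -/

/-- The oriented resolution. -/
def Orientation.vertex (o : D.Orientation) : D.Vertex := fun c => !o.isPositive c

/-- The number of intersections with the diagram of a radial ray that starts at the point `a` and
runs to `O`, not counting `a`, plus `1` if the strand at `a` runs counterclockwise around `X`.
Modulo `2` this is the number of circles of the oriented resolution that separate the circle of
`a` from `O`, plus `1` if that circle is oriented counterclockwise in the plane. -/
def Orientation.depth (o : D.Orientation) (a : D.Point) : ℕ :=
  a.2 + if o.dir a then 1 else 0

theorem resolved_of_not (r : D.Vertex) {s : Fin (D.len + 1)} (h : ¬ (D.piece s).IsCrossing) :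
    D.resolved r s = D.piece s := by
  rw [resolved, dif_neg h]
  revert h
  generalize D.piece s = e
  cases e <;> simp [AnnularPiece.smooth, AnnularPiece.IsCrossing]

theorem resolved_crossing (r : D.Vertex) (c : D.Crossing) :
    D.resolved r c.1 = if r c = (D.piece c.1).handed
      then AnnularPiece.turnback (D.piece c.1).index else AnnularPiece.straight := by
  have h := c.2.eq_cross
  unfold resolved
  rw [dif_pos c.2]
  conv_lhs => rw [h]
  rfl

/-- The oriented resolution turns back exactly at the crossings whose two strands run around `X` in
different directions. -/
theorem Orientation.resolved_vertex (o : D.Orientation) (c : D.Crossing) :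
    D.resolved o.vertex c.1 = if o.dir (D.inOuter c) = o.dir (D.inInner c)
      then AnnularPiece.straight else AnnularPiece.turnback (D.piece c.1).index := by
  rw [resolved_crossing]
  unfold vertex isPositive
  cases (D.piece c.1).handed <;> cases o.dir (D.inOuter c) <;> cases o.dir (D.inInner c) <;> simp

theorem Orientation.dir_outer (o : D.Orientation) (c : D.Crossing) (p' : Fin (D.width (c.1 + 1)))
    (h : (p' : ℕ) = (D.piece c.1).index) : o.dir ⟨c.1 + 1, p'⟩ = o.dir (D.inInner c) := by
  refine o.dir_through c.1 (D.inInner c).2 p' ?_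
  rw [c.2.eq_cross]
  exact Or.inr (Or.inl ⟨rfl, h⟩)

theorem Orientation.dir_inner (o : D.Orientation) (c : D.Crossing) (p' : Fin (D.width (c.1 + 1)))
    (h : (p' : ℕ) = (D.piece c.1).index + 1) : o.dir ⟨c.1 + 1, p'⟩ = o.dir (D.inOuter c) := by
  refine o.dir_through c.1 (D.inOuter c).2 p' ?_
  rw [c.2.eq_cross]
  exact Or.inl ⟨rfl, h⟩

theorem Orientation.dir_other (o : D.Orientation) (c : D.Crossing) (p : Fin (D.width c.1))
    (p' : Fin (D.width (c.1 + 1))) (h1 : (p : ℕ) ≠ (D.piece c.1).index)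
    (h2 : (p : ℕ) ≠ (D.piece c.1).index + 1) (h : (p' : ℕ) = p) :
    o.dir ⟨c.1 + 1, p'⟩ = o.dir ⟨c.1, p⟩ := by
  refine o.dir_through c.1 p p' ?_
  rw [c.2.eq_cross]
  exact Or.inr (Or.inr ⟨h1, h2, h⟩)

theorem Orientation.dir_in_outer (o : D.Orientation) (c : D.Crossing) (p : Fin (D.width c.1))
    (h : (p : ℕ) = (D.piece c.1).index) : o.dir ⟨c.1, p⟩ = o.dir (D.inOuter c) :=
  congrArg (fun x => o.dir ⟨c.1, x⟩) (Fin.ext h)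

theorem Orientation.dir_in_inner (o : D.Orientation) (c : D.Crossing) (p : Fin (D.width c.1))
    (h : (p : ℕ) = (D.piece c.1).index + 1) : o.dir ⟨c.1, p⟩ = o.dir (D.inInner c) :=
  congrArg (fun x => o.dir ⟨c.1, x⟩) (Fin.ext h)

theorem Orientation.depth_joined (o : D.Orientation) {a b : D.Point}
    (h : D.Joined o.vertex a b) : Even (o.depth a) = Even (o.depth b) := by
  unfold depth
  cases h with
  | through s p p' h =>
    have hpar : o.dir ⟨s + 1, p'⟩ = o.dir ⟨s, p⟩ ∧
        ((p' : ℕ) = p ∨ (p' : ℕ) = p + 2 ∨ (p : ℕ) = p' + 2) := by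
      by_cases hs : (D.piece s).IsCrossing
      · have hres := o.resolved_vertex ⟨s, hs⟩
        change D.resolved o.vertex s = _ at hres
        rw [hres] at h
        split_ifs at h with hd
        · have h' : (p' : ℕ) = p := h
          refine ⟨?_, Or.inl h'⟩
          by_cases h1 : (p : ℕ) = (D.piece s).index
          · rw [o.dir_outer ⟨s, hs⟩ p' (h'.trans h1), o.dir_in_outer ⟨s, hs⟩ p h1, hd]
          by_cases h2 : (p : ℕ) = (D.piece s).index + 1
          · rw [o.dir_inner ⟨s, hs⟩ p' (h'.trans h2), o.dir_in_inner ⟨s, hs⟩ p h2, hd]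
          exact o.dir_other ⟨s, hs⟩ p p' h1 h2 h'
        · exact ⟨o.dir_other ⟨s, hs⟩ p p' h.1 h.2.1 h.2.2, Or.inl h.2.2⟩
      · rw [D.resolved_of_not _ hs] at h
        exact ⟨o.dir_through s p p' h, h.near hs⟩
    rw [hpar.1]
    simp only [Nat.even_iff, eq_iff_iff]
    omega
  | turnsIn s p p' h =>
    have hdir : o.dir ⟨s, p'⟩ = !o.dir ⟨s, p⟩ := by
      by_cases hs : (D.piece s).IsCrossing
      · have hres := o.resolved_vertex ⟨s, hs⟩
        change D.resolved o.vertex s = _ at hres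
        rw [hres] at h
        split_ifs at h with hd
        · exact h.elim
        · rw [o.dir_in_outer ⟨s, hs⟩ p h.1, o.dir_in_inner ⟨s, hs⟩ p' h.2]
          exact Bool.eq_not.mpr fun e => hd e.symm
      · rw [D.resolved_of_not _ hs] at h
        exact o.dir_turnsIn s p p' h
    have := h.next
    rw [hdir]
    cases o.dir ⟨s, p⟩ <;> simp [this, Nat.even_add_one]
  | turnsOut s p p' h =>
    have hdir : o.dir ⟨s + 1, p'⟩ = !o.dir ⟨s + 1, p⟩ := by
      by_cases hs : (D.piece s).IsCrossing
      · have hres := o.resolved_vertex ⟨s, hs⟩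
        change D.resolved o.vertex s = _ at hres
        rw [hres] at h
        split_ifs at h with hd
        · exact h.elim
        · rw [o.dir_outer ⟨s, hs⟩ p h.1, o.dir_inner ⟨s, hs⟩ p' h.2]
          exact Bool.eq_not.mpr hd
      · rw [D.resolved_of_not _ hs] at h
        exact o.dir_turnsOut s p p' h
    have := h.next
    rw [hdir]
    cases o.dir ⟨s + 1, p⟩ <;> simp [this, Nat.even_add_one]

/-- Whether a circle of the oriented resolution is labelled by `a = v₋ + v₊` (`true`) or by
`b = v₋ - v₊` (`false`). -/
def Orientation.isA (o : D.Orientation) : D.Circle o.vertex → Bool :=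
  Quot.lift (fun a => decide (Even (o.depth a))) fun _ _ h => by
    simp only [o.depth_joined h]

/-- The coefficient of `v₊` or `v₋` (second argument) in `a` or `b` (first argument). -/
def labelCoeff : Bool → Bool → ℂ
  | false, true => -1
  | _, _ => 1

/-- The canonical chain of an orientation: every circle of the oriented resolution is labelled by
`a` or `b`. -/
noncomputable def Orientation.canonicalChain (o : D.Orientation) : D.Chain :=
  ∑ m : D.Circle o.vertex → Bool,
    (∏ C, labelCoeff (o.isA C) (m C)) • Generator.vec (⟨o.vertex, m⟩ : D.Generator)

theorem leeDiff_vec (x y : D.Generator) : D.leeDiff x.vec y = D.diffCoeff x y := by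
  classical
  simp [leeDiff, Generator.vec]

theorem Orientation.isA_inOuter (o : D.Orientation) (c : D.Crossing) :
    o.isA (D.circleOf o.vertex (D.inOuter c)) = !o.isA (D.circleOf o.vertex (D.outInner c)) := by
  change decide (Even (o.depth (D.inOuter c))) = !decide (Even (o.depth (D.outInner c)))
  have h := o.dir_inner c (D.outInner c).2 rfl
  change o.dir (D.outInner c) = _ at h
  unfold depth
  rw [h]
  change decide (Even ((D.piece c.1).index + _)) = !decide (Even ((D.piece c.1).index + 1 + _))
  cases o.dir (D.inOuter c) <;>
    simp [Nat.even_add_one, -Nat.not_even_iff_odd]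

theorem Orientation.leeDiff_canonicalChain (o : D.Orientation) :
    D.leeDiff o.canonicalChain = 0 := by
  classical
  funext y
  simp only [canonicalChain, map_sum, map_smul, Finset.sum_apply, Pi.smul_apply, leeDiff_vec,
    diffCoeff, smul_eq_mul, Finset.mul_sum, Pi.zero_apply]
  rw [Finset.sum_comm]
  refine Finset.sum_eq_zero fun c _ => ?_
  have hA := o.isA_inOuter c
  set P := D.circleOf o.vertex (D.inOuter c) with hP
  set Q := D.circleOf o.vertex (D.outInner c) with hQ
  have hPQ : P ≠ Q := by
    intro h
    rw [h] at hA
    simp at hA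
  -- flip the markings of the two circles at the crossing
  let flip : (D.Circle o.vertex → Bool) → (D.Circle o.vertex → Bool) :=
    fun m C => if C = P ∨ C = Q then !m C else m C
  have hflip : ∀ m, (∏ C, labelCoeff (o.isA C) (flip m C))
      = -∏ C, labelCoeff (o.isA C) (m C) := by
    intro m
    rw [← Finset.mul_prod_erase _ _ (Finset.mem_univ P),
      ← Finset.mul_prod_erase _ _ (Finset.mem_univ P),
      ← Finset.mul_prod_erase _ _ (Finset.mem_erase.mpr ⟨hPQ.symm, Finset.mem_univ Q⟩),
      ← Finset.mul_prod_erase _ _ (Finset.mem_erase.mpr ⟨hPQ.symm, Finset.mem_univ Q⟩)]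
    have hrest : ∏ C ∈ (Finset.univ.erase P).erase Q, labelCoeff (o.isA C) (flip m C)
        = ∏ C ∈ (Finset.univ.erase P).erase Q, labelCoeff (o.isA C) (m C) := by
      refine Finset.prod_congr rfl fun C hC => ?_
      simp only [Finset.mem_erase] at hC
      simp [flip, hC.1, hC.2.1]
    rw [hrest, ← mul_assoc, ← mul_assoc, ← neg_mul]
    congr 1
    simp only [flip, hA, true_or, or_true, if_true]
    cases o.isA Q <;> cases m P <;> cases m Q <;> simp [labelCoeff]
  have hinv : Function.Involutive flip := by
    intro m
    funext C
    simp only [flip]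
    split_ifs <;> simp
  have hterm : ∀ m, (if D.IsEdge o.vertex y.1 c ∧ D.AgreeAway ⟨o.vertex, flip m⟩ y c then
      D.edgeSign o.vertex c * D.saddleCoeff ⟨o.vertex, flip m⟩ y c else 0)
      = if D.IsEdge o.vertex y.1 c ∧ D.AgreeAway ⟨o.vertex, m⟩ y c then
      D.edgeSign o.vertex c * D.saddleCoeff ⟨o.vertex, m⟩ y c else 0 := by
    intro m
    have h1 : D.AgreeAway ⟨o.vertex, flip m⟩ y c ↔ D.AgreeAway ⟨o.vertex, m⟩ y c := by
      refine forall_congr' fun a => forall_congr' fun h1 => forall_congr' fun h2 => ?_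
      have : Generator.mark ⟨o.vertex, flip m⟩ a = Generator.mark ⟨o.vertex, m⟩ a := by
        change flip m (D.circleOf o.vertex a) = m (D.circleOf o.vertex a)
        exact if_neg (not_or.mpr ⟨h1, h2⟩)
      rw [this]
    have h2 : D.saddleCoeff ⟨o.vertex, flip m⟩ y c = D.saddleCoeff ⟨o.vertex, m⟩ y c := by
      unfold saddleCoeff
      rw [if_pos hPQ, if_pos hPQ]
      change mulCoeff (flip m P) (flip m Q) _ = mulCoeff (m P) (m Q) _
      simp only [flip, true_or, or_true, if_true]
      cases m P <;> cases m Q <;> cases y.mark (D.inOuter c) <;> rfl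
    rw [h1, h2]
  refine self_eq_neg.mp ((Equiv.sum_comp hinv.toPerm _).symm.trans ?_)
  rw [← Finset.sum_neg_distrib]
  refine Finset.sum_congr rfl fun m _ => ?_
  rw [← neg_mul, ← hflip m, ← hterm m]
  rfl

/-- The canonical homology class of an orientation. -/
noncomputable def Orientation.canonicalClass (o : D.Orientation) : D.LeeHomology :=
  D.homologyClass ⟨o.canonicalChain, LinearMap.mem_ker.mpr o.leeDiff_canonicalChain⟩

/-- The annular Rasmussen invariant `d_t`. -/
noncomputable def Orientation.annularRasmussen (o : D.Orientation) (t : ℝ) : ℝ :=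
  o.homologyGrading t o.canonicalClass

end AnnularDiagram


/-!
Lee's differential preserves the quantum grading `j` modulo `4`, so multiplying every generator by
`I ^ j` is an automorphism of the Lee complex. Being diagonal, it preserves every step of the `j_t`
filtration, and up to scalars it exchanges `a = v₋ + v₊` and `b = v₋ - v₊`; hence it carries
`[𝔰_o]` to a nonzero multiple of `[𝔰_ō]`, and the two classes have the same grading. The steps of
the induced filtration of homology are subspaces, so no nonzero combination of the two classes has
a smaller grading.

The congruence modulo `4` rests on the fact that a saddle merges two circles or splits one. The
regions of a complete resolution have a checkerboard colouring, and following each strand with the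
black region on a fixed side is a permutation of the points whose cycles are the circles. A saddle
is compatible with the colouring, and it multiplies this permutation by a transposition.

The class `[𝔰_o]` is nonzero because `𝔰_o` is orthogonal to all boundaries, but not to itself, for
the bilinear form in which the generators are orthonormal: a circle that is split contributes
multiples of `a ⊗ a` and `b ⊗ b`, while the circles of `𝔰_o` that meet at a crossing are labelled
differently.
-/

section

open Equiv

variable {α : Type*}

theorem mul_swap_pow_apply_right [DecidableEq α] {f : Perm α} {x y : α} {n : ℕ}
    (h : ∀ i, 0 < i → i < n → (f ^ i) x ≠ x ∧ (f ^ i) x ≠ y) {i : ℕ} (hi : 0 < i) (hin : i ≤ n) :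
    ((f * swap x y) ^ i) y = (f ^ i) x := by
  induction i, hi using Nat.le_induction with
  | base => simp
  | succ i hi ih =>
    have hne := h i hi hin
    rw [pow_succ', Perm.mul_apply, ih (by omega), Perm.mul_apply,
      swap_apply_of_ne_of_ne hne.1 hne.2, pow_succ', Perm.mul_apply]

theorem exists_first_return [Finite α] (f : Perm α) (x y : α) :
    ∃ n, 0 < n ∧ ((f ^ n) x = x ∨ (f ^ n) x = y) ∧
      ∀ i, 0 < i → i < n → (f ^ i) x ≠ x ∧ (f ^ i) x ≠ y := by
  classical
  have hex : ∃ n, 0 < n ∧ ((f ^ n) x = x ∨ (f ^ n) x = y) :=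
    ⟨orderOf f, orderOf_pos f, .inl (by rw [pow_orderOf_eq_one, Perm.one_apply])⟩
  exact ⟨Nat.find hex, (Nat.find_spec hex).1, (Nat.find_spec hex).2, fun i hi hlt =>
    not_or.1 fun h => Nat.find_min hex hlt ⟨hi, h⟩⟩

theorem sameCycle_iff_exists_pow_lt [Finite α] {f : Perm α} {x y : α} {n : ℕ}
    (hn : 0 < n) (hx : (f ^ n) x = x) : f.SameCycle x y ↔ ∃ i < n, (f ^ i) x = y := by
  refine ⟨fun h => ?_, fun ⟨i, _, h⟩ => ⟨i, by rw [zpow_natCast, h]⟩⟩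
  obtain ⟨k, rfl⟩ := h.exists_nat_pow_eq
  refine ⟨k % n, Nat.mod_lt k hn, ?_⟩
  rw [← Perm.iterate_eq_pow] at hx
  simpa only [Perm.iterate_eq_pow] using Function.IsPeriodicPt.iterate_mod_apply hx k

theorem sameCycle_mul_swap_iff [DecidableEq α] [Finite α] {f : Perm α} {x y : α}
    (hxy : x ≠ y) : (f * swap x y).SameCycle x y ↔ ¬ f.SameCycle x y := by
  obtain ⟨n, hn, hreturn, hmin⟩ := exists_first_return f x y
  have hpow {i : ℕ} (hi : 0 < i) (hin : i ≤ n) := mul_swap_pow_apply_right hmin hi hin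
  rcases hreturn with hx | hy
  · have hmerged : (f * swap x y).SameCycle y x := ⟨n, by rw [zpow_natCast, hpow hn le_rfl, hx]⟩
    refine iff_of_true hmerged.symm fun h => ?_
    obtain ⟨i, hi, hiy⟩ := (sameCycle_iff_exists_pow_lt hn hx).1 h
    rcases i.eq_zero_or_pos with rfl | hpos
    · exact hxy hiy
    · exact (hmin i hpos hi).2 hiy
  · have hsame : f.SameCycle x y := ⟨n, by rw [zpow_natCast, hy]⟩
    refine iff_of_false (fun h => ?_) (not_not.2 hsame)
    obtain ⟨i, hi, hix⟩ :=
      (sameCycle_iff_exists_pow_lt hn ((hpow hn le_rfl).trans hy)).1 h.symm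
    rcases i.eq_zero_or_pos with rfl | hpos
    · exact hxy hix.symm
    · exact (hmin i hpos hi).1 ((hpow hpos hi.le).symm.trans hix)

theorem sameCycle_of_mul_swap [DecidableEq α] [Finite α] {f : Perm α} {x y a b : α}
    (h : (f * swap x y).SameCycle a b) :
    f.SameCycle a b ∨
      (f.SameCycle x a ∨ f.SameCycle y a) ∧ (f.SameCycle x b ∨ f.SameCycle y b) := by
  obtain ⟨n, rfl⟩ := h.exists_nat_pow_eq
  clear h
  induction n with
  | zero => exact .inl (.refl f a)
  | succ n ih =>
    rw [pow_succ', Perm.mul_apply, Perm.mul_apply, Perm.sameCycle_apply_right,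
      Perm.sameCycle_apply_right, Perm.sameCycle_apply_right]
    generalize ((f * swap x y) ^ n) a = b at ih ⊢
    rcases eq_or_ne b x with rfl | hx
    · rw [swap_apply_left]
      exact .inr ⟨ih.elim (fun h => .inl h.symm) And.left, .inr (.refl f y)⟩
    rcases eq_or_ne b y with rfl | hy
    · rw [swap_apply_right]
      exact .inr ⟨ih.elim (fun h => .inr h.symm) And.left, .inl (.refl f x)⟩
    rwa [swap_apply_of_ne_of_ne hx hy]

end

namespace AnnularPiece

variable {e : AnnularPiece} {m n : ℕ}

/-- The arcs inside a sector as a relation between the points on its boundary, those on the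
incoming radial arc in the left summand and those on the outgoing one in the right summand. -/
def Arc (e : AnnularPiece) : Fin m ⊕ Fin n → Fin m ⊕ Fin n → Prop
  | .inl p, .inl p' => e.TurnsIn p p' ∨ e.TurnsIn p' p
  | .inl p, .inr p' => e.Through p p'
  | .inr p', .inl p => e.Through p p'
  | .inr p, .inr p' => e.TurnsOut p p' ∨ e.TurnsOut p' p

theorem Arc.symm {u v : Fin m ⊕ Fin n} (h : e.Arc u v) : e.Arc v u := by
  rcases u with u | u <;> rcases v with v | v <;> first | exact h | exact Or.symm h

theorem Arc.unique (he : ¬ e.IsCrossing) {u v w : Fin m ⊕ Fin n} (hv : e.Arc u v)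
    (hw : e.Arc u w) : v = w := by
  cases e <;> rcases u with u | u <;> rcases v with v | v <;> rcases w with w | w <;>
    simp only [Arc, Through, TurnsIn, TurnsOut, IsCrossing, not_true_eq_false, or_self,
      reduceCtorEq, Sum.inl.injEq, Sum.inr.injEq, Fin.ext_iff] at * <;> omega

theorem Fits.exists_arc_inl (he : ¬ e.IsCrossing) (hf : e.Fits m n) (p : Fin m) :
    ∃ v : Fin m ⊕ Fin n, e.Arc (.inl p) v := by
  obtain ⟨p, hp⟩ := p
  cases e with simp only [Fits] at hf
  | straight => exact ⟨.inr ⟨p, by omega⟩, rfl⟩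
  | cross => exact absurd trivial he
  | turnback q =>
    rcases eq_or_ne p q with h | h
    · exact ⟨.inl ⟨q + 1, by omega⟩, .inl ⟨h, rfl⟩⟩
    rcases eq_or_ne p (q + 1) with h' | h'
    · exact ⟨.inl ⟨q, by omega⟩, .inr ⟨rfl, h'⟩⟩
    · exact ⟨.inr ⟨p, by omega⟩, h, h', rfl⟩
  | birth q =>
    rcases lt_or_ge p q with h | h
    · exact ⟨.inr ⟨p, by omega⟩, .inl ⟨h, rfl⟩⟩
    · exact ⟨.inr ⟨p + 2, by omega⟩, .inr ⟨h, rfl⟩⟩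
  | death q =>
    rcases lt_or_ge p q with h | h
    · exact ⟨.inr ⟨p, by omega⟩, .inl ⟨h, rfl⟩⟩
    rcases eq_or_ne p q with h' | h'
    · exact ⟨.inl ⟨q + 1, by omega⟩, .inl ⟨h', rfl⟩⟩
    rcases eq_or_ne p (q + 1) with h'' | h''
    · exact ⟨.inl ⟨q, by omega⟩, .inr ⟨rfl, h''⟩⟩
    · exact ⟨.inr ⟨p - 2, by omega⟩, .inr ⟨by simp only; omega, by simp only; omega⟩⟩

/-- The piece drawn in the mirror image of the sector, where the two radial arcs are
exchanged. -/
def mirror : AnnularPiece → AnnularPiece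
  | birth q => death q
  | death q => birth q
  | e => e

theorem Arc.of_mirror (he : ¬ e.IsCrossing) {u v : Fin n ⊕ Fin m} (h : e.mirror.Arc u v) :
    e.Arc u.swap v.swap := by
  cases e <;> rcases u with u | u <;> rcases v with v | v <;>
    simp only [mirror, Arc, Through, TurnsIn, TurnsOut, IsCrossing, Sum.swap_inl, Sum.swap_inr,
      not_true_eq_false, or_self] at * <;> omega

theorem Fits.exists_arc (he : ¬ e.IsCrossing) (hf : e.Fits m n) (u : Fin m ⊕ Fin n) :
    ∃ v, e.Arc u v := by
  rcases u with p | p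
  · exact hf.exists_arc_inl he p
  · have hmirror : ¬ e.mirror.IsCrossing ∧ e.mirror.Fits n m := by
      cases e <;> simp_all [mirror, Fits, IsCrossing]
    obtain ⟨v, hv⟩ := hmirror.2.exists_arc_inl hmirror.1 p
    exact ⟨v.swap, hv.of_mirror he⟩

/-- The side, left or right, on which the arc that enters the sector at a point has the black region
of the checkerboard colouring. The colours alternate along a radial arc, and the arcs enter the
sector in opposite directions at its two radial sides. -/
def parity : Fin m ⊕ Fin n → Bool
  | .inl p => Nat.bodd p
  | .inr p => !Nat.bodd p

theorem Arc.parity_eq (he : ¬ e.IsCrossing) {u v : Fin m ⊕ Fin n} (h : e.Arc u v) :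
    parity v = !parity u := by
  rcases u with u | u <;> rcases v with v | v
  · rcases h with h | h <;> simp [parity, h.next]
  · rcases h.near he with h | h | h <;> simp [parity, h]
  · rcases h.near he with h | h | h <;> simp [parity, h]
  · rcases h with h | h <;> simp [parity, h.next]

theorem Arc.turnback_of_straight {q : ℕ} {u v : Fin m ⊕ Fin n} (h : straight.Arc u v)
    {p : Fin m} {p' : Fin n} (hp : (p : ℕ) = q) (hp' : (p' : ℕ) = q + 1)
    (hparity : parity u = parity (n := n) (.inl p)) (hu : u ≠ .inl p) (hu' : u ≠ .inr p') :
    (turnback q).Arc u v := by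
  rcases u with u | u <;> rcases v with v | v <;>
    simp only [Arc, Through, TurnsIn, TurnsOut, or_self] at h ⊢
  · have : (u : ℕ) ≠ q + 1 := fun hq => by simp [parity, hq, hp] at hparity
    exact ⟨fun hq => hu (congrArg _ (Fin.ext (hq.trans hp.symm))), this, h⟩
  · have : (u : ℕ) ≠ q := fun hq => by simp [parity, hq, hp] at hparity
    exact ⟨h ▸ this, fun hq => hu' (congrArg _ (Fin.ext (h.trans (hq.trans hp'.symm)))), h⟩

end AnnularPiece

namespace AnnularDiagram

variable {D : AnnularDiagram}

theorem not_isCrossing_resolved (r : D.Vertex) (s : Fin (D.len + 1)) :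
    ¬ (D.resolved r s).IsCrossing := by
  by_cases h : (D.piece s).IsCrossing
  · rw [D.resolved_crossing r ⟨s, h⟩]
    split_ifs <;> exact id
  · rwa [D.resolved_of_not r h]

theorem resolved_fits (r : D.Vertex) (s : Fin (D.len + 1)) :
    (D.resolved r s).Fits (D.width s) (D.width (s + 1)) := by
  by_cases h : (D.piece s).IsCrossing
  · have hf := h.fits (D.fits s)
    rw [D.resolved_crossing r ⟨s, h⟩]
    split_ifs
    exacts [hf, hf.2]
  · rw [D.resolved_of_not r h]
    exact D.fits s

variable (D) in
/-- An end of an arc of a complete resolution: a sector together with a point on its boundary. -/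
abbrev ArcEnd : Type := Σ s : Fin (D.len + 1), Fin (D.width s) ⊕ Fin (D.width (s + 1))

namespace ArcEnd

/-- The point of the diagram at which an arc ends. -/
def point : D.ArcEnd → D.Point
  | ⟨s, .inl p⟩ => ⟨s, p⟩
  | ⟨s, .inr p⟩ => ⟨s + 1, p⟩

/-- The checkerboard parity of an end. The two ends at a point have different parities, and so have
the two ends of an arc. -/
def parity (x : D.ArcEnd) : Bool := AnnularPiece.parity x.2

theorem ext {x y : D.ArcEnd} (hpoint : x.point = y.point) (hparity : x.parity = y.parity) :
    x = y := by
  have hbodd {s s' : Fin (D.len + 1)} {p : Fin (D.width s)} {p' : Fin (D.width s')}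
      (h : (⟨s, p⟩ : D.Point) = ⟨s', p'⟩) : Nat.bodd p = Nat.bodd p' := by cases h; rfl
  obtain ⟨s, p | p⟩ := x <;> obtain ⟨s', p' | p'⟩ := y
  · cases hpoint; rfl
  · simp [parity, AnnularPiece.parity, hbodd hpoint] at hparity
  · simp [parity, AnnularPiece.parity, hbodd hpoint] at hparity
  · obtain rfl : s = s' := add_right_cancel (congrArg Sigma.fst hpoint)
    cases hpoint; rfl

theorem exists_point_parity_eq (a : D.Point) (b : Bool) :
    ∃ x : D.ArcEnd, x.point = a ∧ x.parity = b := by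
  obtain ⟨s, p⟩ := a
  rcases Bool.eq_or_eq_not b (Nat.bodd p) with rfl | rfl
  · exact ⟨⟨s, .inl p⟩, rfl, rfl⟩
  · obtain ⟨s, rfl⟩ : ∃ s', s' + 1 = s := ⟨s - 1, sub_add_cancel s 1⟩
    exact ⟨⟨s, .inr p⟩, rfl, rfl⟩

/-- The identification of an end with its point and its parity. -/
noncomputable def equivPoint : D.ArcEnd ≃ D.Point × Bool :=
  .ofBijective (fun x => (x.point, x.parity))
    ⟨fun _ _ h => ext (congrArg Prod.fst h) (congrArg Prod.snd h),
      fun ⟨a, b⟩ => (exists_point_parity_eq a b).imp fun _ h => Prod.ext h.1 h.2⟩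

theorem equivPoint_symm (x : D.ArcEnd) : equivPoint.symm (x.point, x.parity) = x :=
  equivPoint.symm_apply_apply x

theorem point_equivPoint_symm (a : D.Point) (b : Bool) : (equivPoint.symm (a, b)).point = a :=
  congrArg Prod.fst (equivPoint.apply_symm_apply (a, b))

theorem parity_equivPoint_symm (a : D.Point) (b : Bool) : (equivPoint.symm (a, b)).parity = b :=
  congrArg Prod.snd (equivPoint.apply_symm_apply (a, b))

/-- The other end of the arc of the complete resolution at `r`. -/
noncomputable def opposite (r : D.Vertex) (x : D.ArcEnd) : D.ArcEnd :=
  ⟨x.1, ((resolved_fits r x.1).exists_arc (not_isCrossing_resolved r x.1) x.2).choose⟩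

theorem arc_opposite (r : D.Vertex) (x : D.ArcEnd) :
    (D.resolved r x.1).Arc x.2 (x.opposite r).2 :=
  ((resolved_fits r x.1).exists_arc (not_isCrossing_resolved r x.1) x.2).choose_spec

theorem opposite_eq_of_arc {r : D.Vertex} {s : Fin (D.len + 1)}
    {u v : Fin (D.width s) ⊕ Fin (D.width (s + 1))} (h : (D.resolved r s).Arc u v) :
    opposite r ⟨s, u⟩ = ⟨s, v⟩ :=
  congrArg (Sigma.mk s) ((arc_opposite r ⟨s, u⟩).unique (not_isCrossing_resolved r s) h)

theorem opposite_opposite (r : D.Vertex) (x : D.ArcEnd) : (x.opposite r).opposite r = x :=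
  opposite_eq_of_arc (arc_opposite r x).symm

theorem parity_opposite (r : D.Vertex) (x : D.ArcEnd) : (x.opposite r).parity = !x.parity :=
  (arc_opposite r x).parity_eq (not_isCrossing_resolved r x.1)

theorem circleOf_eq_of_arc {r : D.Vertex} {s : Fin (D.len + 1)}
    {u v : Fin (D.width s) ⊕ Fin (D.width (s + 1))} (h : (D.resolved r s).Arc u v) :
    D.circleOf r (point ⟨s, u⟩) = D.circleOf r (point ⟨s, v⟩) := by
  rcases u with u | u <;> rcases v with v | v
  · rcases h with h | h
    exacts [Quot.sound (.turnsIn s _ _ h), (Quot.sound (.turnsIn s _ _ h)).symm]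
  · exact Quot.sound (.through s _ _ h)
  · exact (Quot.sound (.through s _ _ h)).symm
  · rcases h with h | h
    exacts [Quot.sound (.turnsOut s _ _ h), (Quot.sound (.turnsOut s _ _ h)).symm]

theorem exists_opposite_of_joined {r : D.Vertex} {a b : D.Point} (h : D.Joined r a b) :
    ∃ x : D.ArcEnd, x.point = a ∧ (x.opposite r).point = b := by
  have opposite_eq {s : Fin (D.len + 1)} {u v} (h : (D.resolved r s).Arc u v) :
      (opposite r ⟨s, u⟩).point = point ⟨s, v⟩ := congrArg point (opposite_eq_of_arc h)
  cases h with
  | through s p p' h => exact ⟨⟨s, .inl p⟩, rfl, opposite_eq (v := .inr p') h⟩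
  | turnsIn s p p' h => exact ⟨⟨s, .inl p⟩, rfl, opposite_eq (v := .inl p') (Or.inl h)⟩
  | turnsOut s p p' h => exact ⟨⟨s, .inr p⟩, rfl, opposite_eq (v := .inr p') (Or.inl h)⟩

end ArcEnd

open ArcEnd

/-- The permutation of the points that follows from each point the arc which leaves it through the
end of parity `e`. Its cycles are the circles of the complete resolution. -/
noncomputable def stepPerm (r : D.Vertex) (e : Bool) : Equiv.Perm D.Point where
  toFun a := ((equivPoint.symm (a, e)).opposite r).point
  invFun a := ((equivPoint.symm (a, !e)).opposite r).point
  left_inv a := by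
    have h := equivPoint_symm ((equivPoint.symm (a, e)).opposite r)
    rw [parity_opposite, parity_equivPoint_symm] at h
    simp only [h, opposite_opposite, point_equivPoint_symm]
  right_inv a := by
    have h := equivPoint_symm ((equivPoint.symm (a, !e)).opposite r)
    rw [parity_opposite, parity_equivPoint_symm, Bool.not_not] at h
    simp only [h, opposite_opposite, point_equivPoint_symm]

theorem stepPerm_point (r : D.Vertex) (x : D.ArcEnd) :
    stepPerm r x.parity x.point = (x.opposite r).point := by
  rw [stepPerm, Equiv.coe_fn_mk, equivPoint_symm]

theorem circleOf_stepPerm (r : D.Vertex) (e : Bool) (a : D.Point) :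
    D.circleOf r (stepPerm r e a) = D.circleOf r a :=
  (circleOf_eq_of_arc (arc_opposite r _)).symm.trans (congrArg _ (point_equivPoint_symm a e))

theorem sameCycle_stepPerm_of_joined {r : D.Vertex} {a b : D.Point} (h : D.Joined r a b)
    (e : Bool) : (stepPerm r e).SameCycle a b := by
  obtain ⟨x, rfl, rfl⟩ := exists_opposite_of_joined h
  rcases Bool.eq_or_eq_not e x.parity with rfl | rfl
  · exact ⟨1, by rw [zpow_one, stepPerm_point]⟩
  · refine Equiv.Perm.SameCycle.symm ⟨1, ?_⟩
    rw [zpow_one, ← parity_opposite r, stepPerm_point, opposite_opposite]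

theorem circleOf_eq_iff {r : D.Vertex} (e : Bool) {a b : D.Point} :
    D.circleOf r a = D.circleOf r b ↔ (stepPerm r e).SameCycle a b := by
  constructor
  · intro h
    replace h := Quot.eqvGen_exact h
    induction h with
    | rel a b h => exact sameCycle_stepPerm_of_joined h e
    | refl a => exact .refl _ a
    | symm a b _ ih => exact ih.symm
    | trans a b c _ _ ih ih' => exact ih.trans ih'
  · intro h
    obtain ⟨n, rfl⟩ := h.exists_nat_pow_eq
    clear h
    induction n with
    | zero => rfl
    | succ n ih => rw [pow_succ', Equiv.Perm.mul_apply, circleOf_stepPerm, ih]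

/-- The end in the sector of `c` at the point `inOuter c`. -/
def outerEnd (c : D.Crossing) : D.ArcEnd := ⟨c.1, .inl (D.inOuter c).2⟩

/-- The end in the sector of `c` at the point `outInner c`. This and `outerEnd c` are the two of the
four ends at `c` of one parity; the two smoothings of `c` join them in the two ways to the ends of
the other parity. -/
def innerEnd (c : D.Crossing) : D.ArcEnd := ⟨c.1, .inr (D.outInner c).2⟩

theorem parity_innerEnd (c : D.Crossing) : (innerEnd c).parity = (outerEnd c).parity := by
  simp [parity, AnnularPiece.parity, innerEnd, outerEnd, inOuter, outInner]

theorem inOuter_ne_outInner (c : D.Crossing) : D.inOuter c ≠ D.outInner c := fun h =>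
  have heq : outerEnd c = innerEnd c := ArcEnd.ext h (parity_innerEnd c).symm
  Sum.inl_ne_inr (eq_of_heq (Sigma.mk.inj heq).2)

section Smoothings

variable {r r' : D.Vertex} {c : D.Crossing} (hstraight : D.resolved r c.1 = .straight)
  (hturn : D.resolved r' c.1 = .turnback (D.piece c.1).index)

include hstraight hturn

theorem opposite_outerEnd_eq : (outerEnd c).opposite r' = (innerEnd c).opposite r := by
  have hc : (D.resolved r' c.1).Arc (outerEnd c).2 (.inl (D.inInner c).2) := by
    rw [hturn]; exact .inl ⟨rfl, rfl⟩
  have hc' : (D.resolved r c.1).Arc (innerEnd c).2 (.inl (D.inInner c).2) := by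
    rw [hstraight]; rfl
  exact (opposite_eq_of_arc hc).trans (opposite_eq_of_arc hc').symm

theorem opposite_innerEnd_eq : (innerEnd c).opposite r' = (outerEnd c).opposite r := by
  have hwidth := (c.2.fits (D.fits c.1))
  let p : Fin (D.width (c.1 + 1)) := ⟨(D.piece c.1).index, by omega⟩
  have hc : (D.resolved r' c.1).Arc (innerEnd c).2 (.inr p) := by
    rw [hturn]; exact .inr ⟨rfl, rfl⟩
  have hc' : (D.resolved r c.1).Arc (outerEnd c).2 (.inr p) := by
    rw [hstraight]; rfl
  exact (opposite_eq_of_arc hc).trans (opposite_eq_of_arc hc').symm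

theorem opposite_eq_of_ne (haway : ∀ s ≠ c.1, D.resolved r' s = D.resolved r s) {x : D.ArcEnd}
    (hparity : x.parity = (outerEnd c).parity) (houter : x ≠ outerEnd c)
    (hinner : x ≠ innerEnd c) : x.opposite r' = x.opposite r := by
  obtain ⟨s, u⟩ := x
  refine opposite_eq_of_arc ?_
  have harc := arc_opposite r ⟨s, u⟩
  by_cases hs : s = c.1
  · subst hs
    rw [hturn]
    rw [hstraight] at harc
    exact harc.turnback_of_straight rfl rfl hparity (fun h => houter (congrArg _ h))
      fun h => hinner (congrArg _ h)
  · rwa [haway s hs]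

theorem stepPerm_eq_mul_swap [DecidableEq D.Point]
    (haway : ∀ s ≠ c.1, D.resolved r' s = D.resolved r s) :
    stepPerm r' (outerEnd c).parity
      = stepPerm r (outerEnd c).parity * Equiv.swap (D.inOuter c) (D.outInner c) := by
  ext1 a
  obtain ⟨x, rfl, hparity⟩ := exists_point_parity_eq a (outerEnd c).parity
  have step (r) {x : D.ArcEnd} (h : x.parity = (outerEnd c).parity) :
      stepPerm r (outerEnd c).parity x.point = (x.opposite r).point := h ▸ stepPerm_point r x
  have point_ne {y : D.ArcEnd} (hy : y.parity = (outerEnd c).parity) (h : x ≠ y) :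
      x.point ≠ y.point := fun hpoint => h (ArcEnd.ext hpoint (hparity.trans hy.symm))
  change stepPerm r' _ x.point
    = stepPerm r _ (Equiv.swap (outerEnd c).point (innerEnd c).point x.point)
  rw [step r' hparity]
  rcases eq_or_ne x (outerEnd c) with rfl | houter
  · rw [Equiv.swap_apply_left, step r (parity_innerEnd c), opposite_outerEnd_eq hstraight hturn]
  rcases eq_or_ne x (innerEnd c) with rfl | hinner
  · rw [Equiv.swap_apply_right, step r rfl, opposite_innerEnd_eq hstraight hturn]
  · rw [Equiv.swap_apply_of_ne_of_ne (point_ne rfl houter) (point_ne (parity_innerEnd c) hinner),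
      step r hparity, opposite_eq_of_ne hstraight hturn haway hparity houter hinner]

end Smoothings

theorem IsEdge.resolved_eq {r r' : D.Vertex} {c : D.Crossing} (h : D.IsEdge r r' c)
    {s : Fin (D.len + 1)} (hs : s ≠ c.1) : D.resolved r' s = D.resolved r s := by
  by_cases hcross : (D.piece s).IsCrossing
  · simp only [D.resolved_crossing _ ⟨s, hcross⟩,
      h.2.2 ⟨s, hcross⟩ fun heq => hs (congrArg Subtype.val heq)]
  · rw [D.resolved_of_not r hcross, D.resolved_of_not r' hcross]

theorem IsEdge.stepPerm_eq [DecidableEq D.Point] {r r' : D.Vertex} {c : D.Crossing}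
    (h : D.IsEdge r r' c) :
    stepPerm r' (outerEnd c).parity
      = stepPerm r (outerEnd c).parity * Equiv.swap (D.inOuter c) (D.outInner c) := by
  have hr := D.resolved_crossing r c
  have hr' := D.resolved_crossing r' c
  rw [h.1] at hr
  rw [h.2.1] at hr'
  cases hhanded : (D.piece c.1).handed <;>
    simp only [hhanded, if_true, Bool.false_eq_true, Bool.true_eq_false, if_false] at hr hr'
  · rw [stepPerm_eq_mul_swap hr' hr fun s hs => (h.resolved_eq hs).symm, mul_assoc,
      Equiv.swap_mul_self, mul_one]
  · exact stepPerm_eq_mul_swap hr hr' fun s hs => h.resolved_eq hs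

section Edge

variable {r r' : D.Vertex} {c : D.Crossing}

/-- The circle `C` of the complete resolution at `r` passes through the crossing `c`. -/
def Touches (c : D.Crossing) (C : D.Circle r) : Prop :=
  D.circleOf r (D.inOuter c) = C ∨ D.circleOf r (D.outInner c) = C

theorem circleOf_eq_or_touches [DecidableEq D.Point] {e : Bool}
    (hstep : stepPerm r' e = stepPerm r e * Equiv.swap (D.inOuter c) (D.outInner c))
    {a b : D.Point} (hab : D.circleOf r' a = D.circleOf r' b) :
    D.circleOf r a = D.circleOf r b ∨ Touches c (D.circleOf r a) ∧ Touches c (D.circleOf r b) := by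
  rw [circleOf_eq_iff e, hstep] at hab
  simpa only [Touches, circleOf_eq_iff e] using sameCycle_of_mul_swap hab

theorem IsEdge.circleOf_eq_iff_ne (h : D.IsEdge r r' c) :
    D.circleOf r' (D.inOuter c) = D.circleOf r' (D.outInner c) ↔
      D.circleOf r (D.inOuter c) ≠ D.circleOf r (D.outInner c) := by
  classical
  rw [ne_eq, circleOf_eq_iff (outerEnd c).parity, circleOf_eq_iff (outerEnd c).parity,
    h.stepPerm_eq, sameCycle_mul_swap_iff (inOuter_ne_outInner c)]

theorem IsEdge.circleOf_eq_or_touches_left (h : D.IsEdge r r' c) {a b : D.Point}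
    (hab : D.circleOf r' a = D.circleOf r' b) :
    D.circleOf r a = D.circleOf r b ∨ Touches c (D.circleOf r a) ∧ Touches c (D.circleOf r b) := by
  classical
  exact circleOf_eq_or_touches h.stepPerm_eq hab

theorem IsEdge.circleOf_eq_or_touches_right (h : D.IsEdge r r' c) {a b : D.Point}
    (hab : D.circleOf r a = D.circleOf r b) :
    D.circleOf r' a = D.circleOf r' b ∨
      Touches c (D.circleOf r' a) ∧ Touches c (D.circleOf r' b) := by
  classical
  refine circleOf_eq_or_touches (e := (outerEnd c).parity) ?_ hab
  rw [h.stepPerm_eq, mul_assoc, Equiv.swap_mul_self, mul_one]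

theorem IsEdge.touches_iff (h : D.IsEdge r r' c) (a : D.Point) :
    Touches c (D.circleOf r' a) ↔ Touches c (D.circleOf r a) := by
  constructor <;> rintro (ha | ha)
  · exact (h.circleOf_eq_or_touches_left ha).elim .inl And.right
  · exact (h.circleOf_eq_or_touches_left ha).elim .inr And.right
  · exact (h.circleOf_eq_or_touches_right ha).elim .inl And.right
  · exact (h.circleOf_eq_or_touches_right ha).elim .inr And.right

theorem circleOf_out (C : D.Circle r) : D.circleOf r (Quot.out C) = C := Quot.out_eq C

/-- The circles that do not pass through `c` are the same at both ends of an edge of the cube that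
changes the smoothing of `c`. -/
noncomputable def IsEdge.awayEquiv (h : D.IsEdge r r' c) :
    {C : D.Circle r // ¬ Touches c C} ≃ {C : D.Circle r' // ¬ Touches c C} where
  toFun C := ⟨D.circleOf r' (Quot.out C.1), by rw [h.touches_iff, circleOf_out]; exact C.2⟩
  invFun C := ⟨D.circleOf r (Quot.out C.1), by rw [← h.touches_iff, circleOf_out]; exact C.2⟩
  left_inv C := Subtype.ext <| by
    rcases h.circleOf_eq_or_touches_left (circleOf_out (D.circleOf r' (Quot.out C.1))) with
      heq | ⟨-, htouches⟩
    · exact heq.trans (circleOf_out C.1)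
    · exact absurd ((circleOf_out C.1) ▸ htouches) C.2
  right_inv C := Subtype.ext <| by
    rcases h.circleOf_eq_or_touches_right (circleOf_out (D.circleOf r (Quot.out C.1))) with
      heq | ⟨-, htouches⟩
    · exact heq.trans (circleOf_out C.1)
    · exact absurd ((circleOf_out C.1) ▸ htouches) C.2

open Classical in
theorem AgreeAway.prod_away_eq {M : Type*} [CommMonoid M] {x y : D.Generator}
    (hxy : D.AgreeAway x y c) (h : D.IsEdge x.1 y.1 c) (φ : Bool → M) :
    ∏ C : {C : D.Circle x.1 // ¬ Touches c C}, φ (x.2 C)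
      = ∏ C : {C : D.Circle y.1 // ¬ Touches c C}, φ (y.2 C) := by
  refine Fintype.prod_equiv h.awayEquiv _ _ fun ⟨C, hC⟩ => congrArg φ ?_
  obtain ⟨a, rfl⟩ : ∃ a, D.circleOf x.1 a = C := ⟨_, circleOf_out C⟩
  have hmark := hxy (Quot.out (D.circleOf x.1 a))
  rw [circleOf_out, Generator.mark, Generator.mark, circleOf_out] at hmark
  exact (hmark (fun heq => hC (.inl heq.symm)) fun heq => hC (.inr heq.symm)).symm

open Classical in
theorem prod_circle_of_ne {M : Type*} [CommMonoid M] (F : D.Circle r → M)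
    (h : D.circleOf r (D.inOuter c) ≠ D.circleOf r (D.outInner c)) :
    ∏ C, F C = F (D.circleOf r (D.inOuter c)) * F (D.circleOf r (D.outInner c)) *
      ∏ C : {C : D.Circle r // ¬ Touches c C}, F C := by
  rw [← Fintype.prod_subtype_mul_prod_subtype (Touches c) F, ← Finset.prod_pair h,
    Finset.prod_subtype (p := Touches c) _ fun C => by simp [Touches, eq_comm]]

open Classical in
theorem prod_circle_of_eq {M : Type*} [CommMonoid M] (F : D.Circle r → M)
    (h : D.circleOf r (D.inOuter c) = D.circleOf r (D.outInner c)) :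
    ∏ C, F C = F (D.circleOf r (D.inOuter c)) *
      ∏ C : {C : D.Circle r // ¬ Touches c C}, F C := by
  rw [← Fintype.prod_subtype_mul_prod_subtype (Touches c) F,
    ← Finset.prod_singleton F (D.circleOf r (D.inOuter c)),
    Finset.prod_subtype (p := Touches c) _ fun C => by simp [Touches, ← h, eq_comm]]

theorem IsEdge.card_eq (h : D.IsEdge r r' c) :
    Nat.card {c : D.Crossing // r' c = true} = Nat.card {c : D.Crossing // r c = true} + 1 := by
  classical
  have hinsert : ({c' | r' c' = true} : Set D.Crossing) = insert c {c' | r c' = true} := by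
    ext c'
    rcases eq_or_ne c' c with rfl | hc
    · simp [h.2.1]
    · simp [hc, h.2.2 c' hc]
  change Set.ncard {c' | r' c' = true} = Set.ncard {c' | r c' = true} + 1
  rw [hinsert, Set.ncard_insert_of_notMem (by simp [h.1])]

end Edge

section Twist

/-- The factor by which a mark contributes to the weight of a generator. -/
noncomputable def markWeight (b : Bool) : ℂ := if b then Complex.I else -Complex.I

/-- The imaginary unit to the power of the quantum grading, up to a factor that is the same for all
generators. -/
noncomputable def weight (x : D.Generator) : ℂ :=
  Complex.I ^ Nat.card {c : D.Crossing // x.1 c = true} * ∏ C, markWeight (x.2 C)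

theorem markWeight_mul_of_mulCoeff_ne_zero {a b d : Bool} (h : mulCoeff a b d ≠ 0) :
    markWeight a * markWeight b = Complex.I * markWeight d := by
  revert h
  cases a <;> cases b <;> cases d <;> simp [mulCoeff, markWeight]

theorem markWeight_eq_of_comulCoeff_ne_zero {a b d : Bool} (h : comulCoeff a b d ≠ 0) :
    markWeight a = Complex.I * (markWeight b * markWeight d) := by
  revert h
  cases a <;> cases b <;> cases d <;> simp [comulCoeff, markWeight]

theorem weight_eq_of_saddleCoeff_ne_zero {x y : D.Generator} {c : D.Crossing}
    (h : D.IsEdge x.1 y.1 c) (hxy : D.AgreeAway x y c) (hs : D.saddleCoeff x y c ≠ 0) :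
    weight x = weight y := by
  have haway := hxy.prod_away_eq h markWeight
  rw [weight, weight, h.card_eq, pow_succ, mul_assoc]
  congr 1
  by_cases hx : D.circleOf x.1 (D.inOuter c) = D.circleOf x.1 (D.outInner c)
  · have hsplit : D.circleOf y.1 (D.inOuter c) ≠ D.circleOf y.1 (D.outInner c) :=
      fun hy => h.circleOf_eq_iff_ne.1 hy hx
    rw [saddleCoeff, if_neg (not_not.2 hx)] at hs
    rw [prod_circle_of_eq _ hx, prod_circle_of_ne _ hsplit, haway, ← mul_assoc]
    exact congrArg (· * _) (markWeight_eq_of_comulCoeff_ne_zero hs)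
  · have hmerge := h.circleOf_eq_iff_ne.2 hx
    rw [saddleCoeff, if_pos hx] at hs
    rw [prod_circle_of_ne _ hx, prod_circle_of_eq _ hmerge, haway, ← mul_assoc]
    exact congrArg (· * _) (markWeight_mul_of_mulCoeff_ne_zero hs)

theorem weight_eq_of_diffCoeff_ne_zero {x y : D.Generator} (h : D.diffCoeff x y ≠ 0) :
    weight x = weight y := by
  obtain ⟨c, -, hc⟩ := Finset.exists_ne_zero_of_sum_ne_zero h
  split_ifs at hc with hxy
  · exact weight_eq_of_saddleCoeff_ne_zero hxy.1 hxy.2 (right_ne_zero_of_mul hc)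
  · exact absurd rfl hc

variable (D) in
/-- The automorphism of the Lee complex that multiplies every generator by its weight. -/
noncomputable def twist : D.Chain →ₗ[ℂ] D.Chain :=
  LinearMap.pi fun x => weight x • LinearMap.proj x

theorem twist_apply (z : D.Chain) (x : D.Generator) : D.twist z x = weight x * z x := rfl

theorem leeDiff_apply (z : D.Chain) (y : D.Generator) :
    D.leeDiff z y = ∑ x, D.diffCoeff x y * z x := rfl

/-- Lee's differential preserves the quantum grading modulo `4`. -/
theorem leeDiff_twist (z : D.Chain) : D.leeDiff (D.twist z) = D.twist (D.leeDiff z) := by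
  funext y
  rw [twist_apply, leeDiff_apply, leeDiff_apply, Finset.mul_sum]
  refine Finset.sum_congr rfl fun x _ => ?_
  by_cases h : D.diffCoeff x y = 0
  · rw [h, zero_mul, zero_mul, mul_zero]
  · rw [twist_apply, weight_eq_of_diffCoeff_ne_zero h, mul_left_comm]

theorem twist_vec (x : D.Generator) : D.twist x.vec = weight x • x.vec := by
  funext y
  rw [twist_apply, Pi.smul_apply, Generator.vec, smul_eq_mul]
  rcases eq_or_ne y x with rfl | h
  · rfl
  · rw [Pi.single_eq_of_ne h, mul_zero, mul_zero]

end Twist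

section LabelledChain

variable {r : D.Vertex}

/-- The chain given by a labelling of the circles of a complete resolution by `a` (`true`) and `b`
(`false`). -/
noncomputable def labelledChain (r : D.Vertex) (l : D.Circle r → Bool) : D.Chain :=
  ∑ m : D.Circle r → Bool, (∏ C, labelCoeff (l C) (m C)) • Generator.vec (⟨r, m⟩ : D.Generator)

theorem labelledChain_congr {r' : D.Vertex} (h : r = r') {l : D.Circle r → Bool}
    {l' : D.Circle r' → Bool} (hl : ∀ a, l (D.circleOf r a) = l' (D.circleOf r' a)) :
    labelledChain r l = labelledChain r' l' := by
  subst h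
  exact congrArg _ (funext (Quot.ind hl))

theorem labelCoeff_mul_markWeight (l m : Bool) :
    labelCoeff l m * markWeight m = -Complex.I * labelCoeff (!l) m := by
  cases l <;> cases m <;> simp [labelCoeff, markWeight]

theorem twist_labelledChain (l : D.Circle r → Bool) : ∃ ζ : ℂ, ζ ≠ 0 ∧
    D.twist (labelledChain r l) = ζ • labelledChain r fun C => !l C := by
  refine ⟨Complex.I ^ Nat.card {c : D.Crossing // r c = true} * ∏ _C : D.Circle r, -Complex.I,
    mul_ne_zero (pow_ne_zero _ Complex.I_ne_zero)
      (Finset.prod_ne_zero_iff.2 fun _ _ => neg_ne_zero.2 Complex.I_ne_zero), ?_⟩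
  simp only [labelledChain, map_sum, map_smul, twist_vec, Finset.smul_sum, smul_smul]
  refine Finset.sum_congr rfl fun m _ => congrArg (· • _) ?_
  rw [weight, mul_left_comm, mul_assoc, ← Finset.prod_mul_distrib, ← Finset.prod_mul_distrib]
  simp only [labelCoeff_mul_markWeight]

theorem labelledChain_dotProduct (l : D.Circle r → Bool) (z : D.Chain) :
    labelledChain r l ⬝ᵥ z
      = ∑ m : D.Circle r → Bool, (∏ C, labelCoeff (l C) (m C)) * z ⟨r, m⟩ := by
  classical
  simp [labelledChain, sum_dotProduct, Generator.vec]

theorem labelledChain_apply (l m : D.Circle r → Bool) :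
    labelledChain r l ⟨r, m⟩ = ∏ C, labelCoeff (l C) (m C) := by
  classical
  have h := labelledChain_dotProduct l (Generator.vec ⟨r, m⟩)
  rw [Generator.vec, dotProduct_single_one] at h
  rw [h, Finset.sum_eq_single_of_mem m (Finset.mem_univ m), Pi.single_eq_same, mul_one]
  intro m' _ hne
  rw [Pi.single_eq_of_ne fun heq => hne (eq_of_heq (Sigma.mk.inj heq).2), mul_zero]

theorem labelledChain_dotProduct_self (l : D.Circle r → Bool) :
    labelledChain r l ⬝ᵥ labelledChain r l ≠ 0 := by
  have hsq (m : D.Circle r → Bool) :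
      (∏ C, labelCoeff (l C) (m C)) * labelledChain r l ⟨r, m⟩ = 1 := by
    rw [labelledChain_apply, ← Finset.prod_mul_distrib]
    exact Finset.prod_eq_one fun C _ => by cases l C <;> cases m C <;> simp [labelCoeff]
  simp [labelledChain_dotProduct, hsq]

variable {c : D.Crossing}

open Classical in
/-- Change the marks of the circles through a crossing. -/
noncomputable def flipMarks (c : D.Crossing) (m : D.Circle r → Bool) : D.Circle r → Bool :=
  fun C => if Touches c C then !m C else m C

theorem flipMarks_of_touches (m : D.Circle r → Bool) {C : D.Circle r} (hC : Touches c C) :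
    flipMarks c m C = !m C :=
  if_pos hC

theorem flipMarks_of_not_touches (m : D.Circle r → Bool) {C : D.Circle r} (hC : ¬ Touches c C) :
    flipMarks c m C = m C :=
  if_neg hC

theorem flipMarks_involutive : Function.Involutive (flipMarks (r := r) c) := fun m => by
  funext C
  by_cases hC : Touches c C
  · rw [flipMarks_of_touches _ hC, flipMarks_of_touches _ hC, Bool.not_not]
  · rw [flipMarks_of_not_touches _ hC, flipMarks_of_not_touches _ hC]

theorem prod_labelCoeff_flipMarks {l : D.Circle r → Bool}
    (hl : l (D.circleOf r (D.inOuter c)) = !l (D.circleOf r (D.outInner c)))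
    (m : D.Circle r → Bool) :
    ∏ C, labelCoeff (l C) (flipMarks c m C) = -∏ C, labelCoeff (l C) (m C) := by
  have hne : D.circleOf r (D.inOuter c) ≠ D.circleOf r (D.outInner c) := fun h => by
    simp [h] at hl
  have haway (C : {C : D.Circle r // ¬ Touches c C}) : flipMarks c m C = m C :=
    flipMarks_of_not_touches m C.2
  simp only [prod_circle_of_ne _ hne, haway, ← neg_mul, flipMarks_of_touches m (.inl rfl),
    flipMarks_of_touches m (.inr rfl), hl]
  congr 1
  cases l (D.circleOf r (D.outInner c)) <;> cases m (D.circleOf r (D.inOuter c)) <;>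
    cases m (D.circleOf r (D.outInner c)) <;> simp [labelCoeff]

theorem agreeAway_flipMarks_iff {x : D.Generator} (h : D.IsEdge x.1 r c)
    (m : D.Circle r → Bool) :
    D.AgreeAway x ⟨r, flipMarks c m⟩ c ↔ D.AgreeAway x ⟨r, m⟩ c := by
  refine forall_congr' fun a => forall_congr' fun houter => forall_congr' fun hinner => ?_
  have hmark : Generator.mark ⟨r, flipMarks c m⟩ a = Generator.mark ⟨r, m⟩ a :=
    flipMarks_of_not_touches m ((h.touches_iff a).not.2 (not_or.2 ⟨houter.symm, hinner.symm⟩))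
  rw [hmark]

theorem saddleCoeff_flipMarks {x : D.Generator}
    (h : D.circleOf x.1 (D.inOuter c) = D.circleOf x.1 (D.outInner c)) (m : D.Circle r → Bool) :
    D.saddleCoeff x ⟨r, flipMarks c m⟩ c = D.saddleCoeff x ⟨r, m⟩ c := by
  simp only [saddleCoeff, if_neg (not_not.2 h), Generator.mark,
    flipMarks_of_touches m (.inl rfl), flipMarks_of_touches m (.inr rfl)]
  cases x.2 (D.circleOf x.1 (D.inOuter c)) <;> cases m (D.circleOf r (D.inOuter c)) <;>
    cases m (D.circleOf r (D.outInner c)) <;> rfl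

/-- The terms cancel in pairs: flipping the marks of the two circles that result from a split
preserves the coefficients of the coproduct and negates those of `a ⊗ b`. -/
theorem sum_labelCoeff_mul_saddleCoeff {l : D.Circle r → Bool}
    (hl : l (D.circleOf r (D.inOuter c)) = !l (D.circleOf r (D.outInner c)))
    {x : D.Generator} (h : D.IsEdge x.1 r c) [∀ m, Decidable (D.AgreeAway x ⟨r, m⟩ c)] :
    ∑ m : D.Circle r → Bool, (∏ C, labelCoeff (l C) (m C)) *
      (if D.AgreeAway x ⟨r, m⟩ c then D.edgeSign x.1 c * D.saddleCoeff x ⟨r, m⟩ c else 0) = 0 := by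
  have hsplit : D.circleOf x.1 (D.inOuter c) = D.circleOf x.1 (D.outInner c) := by
    by_contra hne
    simp [h.circleOf_eq_iff_ne.2 hne] at hl
  refine self_eq_neg.1 ((Equiv.sum_comp (flipMarks_involutive (c := c)).toPerm _).symm.trans ?_)
  simp only [Function.Involutive.coe_toPerm, prod_labelCoeff_flipMarks hl,
    agreeAway_flipMarks_iff h, saddleCoeff_flipMarks hsplit, neg_mul, Finset.sum_neg_distrib]

theorem labelledChain_dotProduct_leeDiff {l : D.Circle r → Bool}
    (hl : ∀ c, l (D.circleOf r (D.inOuter c)) = !l (D.circleOf r (D.outInner c)))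
    (z : D.Chain) : labelledChain r l ⬝ᵥ D.leeDiff z = 0 := by
  classical
  have hcoeff (x : D.Generator) :
      ∑ m : D.Circle r → Bool, (∏ C, labelCoeff (l C) (m C)) * D.diffCoeff x ⟨r, m⟩ = 0 := by
    simp only [diffCoeff, Finset.mul_sum]
    rw [Finset.sum_comm]
    refine Finset.sum_eq_zero fun c _ => ?_
    by_cases h : D.IsEdge x.1 r c
    · simpa only [h, true_and] using sum_labelCoeff_mul_saddleCoeff (hl c) h
    · simp only [h, false_and, if_false, mul_zero, Finset.sum_const_zero]
  simp only [labelledChain_dotProduct, leeDiff_apply, Finset.mul_sum]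
  rw [Finset.sum_comm]
  simp only [← mul_assoc, ← Finset.sum_mul, hcoeff, zero_mul, Finset.sum_const_zero]

end LabelledChain

theorem homologyClass_eq_zero_iff {z : LinearMap.ker D.leeDiff} :
    D.homologyClass z = 0 ↔ (z : D.Chain) ∈ LinearMap.range D.leeDiff :=
  Submodule.Quotient.mk_eq_zero _

theorem twist_mem_ker_leeDiff {z : D.Chain} (hz : z ∈ LinearMap.ker D.leeDiff) :
    D.twist z ∈ LinearMap.ker D.leeDiff := by
  rw [LinearMap.mem_ker, leeDiff_twist, hz, map_zero]

variable (D) in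
/-- The automorphism of Lee homology induced by `twist`. -/
noncomputable def twistHomology : D.LeeHomology →ₗ[ℂ] D.LeeHomology :=
  Submodule.mapQ _ _ (D.twist.restrict fun _ => twist_mem_ker_leeDiff) fun _ ⟨w, hw⟩ =>
    ⟨D.twist w, (leeDiff_twist w).trans (congrArg D.twist hw)⟩

namespace Orientation

variable (o : D.Orientation)

theorem isPositive_reverse : o.reverse.isPositive = o.isPositive := by
  funext c
  simp only [isPositive, reverse]
  cases o.dir (D.inOuter c) <;> cases o.dir (D.inInner c) <;> rfl

theorem reverse_reverse : o.reverse.reverse = o := by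
  cases o
  simp only [reverse, Bool.not_not]

theorem vertex_reverse : o.reverse.vertex = o.vertex := by
  unfold vertex
  rw [isPositive_reverse]

theorem even_depth_reverse (a : D.Point) : Even (o.reverse.depth a) ↔ ¬ Even (o.depth a) := by
  change Even ((a.2 : ℕ) + if !o.dir a then 1 else 0) ↔
    ¬ Even ((a.2 : ℕ) + if o.dir a then 1 else 0)
  cases o.dir a <;> simp [Nat.even_add_one, -Nat.not_even_iff_odd]

theorem twist_canonicalChain :
    ∃ ζ : ℂ, ζ ≠ 0 ∧ D.twist o.canonicalChain = ζ • o.reverse.canonicalChain := by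
  obtain ⟨ζ, hζ, h⟩ := twist_labelledChain o.isA
  refine ⟨ζ, hζ, h.trans (congrArg _ (labelledChain_congr o.vertex_reverse.symm fun a => ?_))⟩
  change (!decide (Even (o.depth a))) = decide (Even (o.reverse.depth a))
  rw [← decide_not, decide_eq_decide, even_depth_reverse]

theorem canonicalClass_ne_zero : o.canonicalClass ≠ 0 := fun h => by
  obtain ⟨z, hz⟩ := homologyClass_eq_zero_iff.1 h
  refine labelledChain_dotProduct_self o.isA ?_
  have hpair := labelledChain_dotProduct_leeDiff o.isA_inOuter z
  rwa [hz] at hpair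

theorem twistHomology_canonicalClass :
    ∃ ζ : ℂ, ζ ≠ 0 ∧ D.twistHomology o.canonicalClass = ζ • o.reverse.canonicalClass := by
  obtain ⟨ζ, hζ, h⟩ := o.twist_canonicalChain
  exact ⟨ζ, hζ, congrArg D.homologyClass (Subtype.ext h)⟩

variable {o} {t a : ℝ}

theorem mem_filtration {z : D.Chain} :
    z ∈ o.filtration t a ↔ ∀ x, z x ≠ 0 → a ≤ o.jtGrading t x := by
  classical
  have hvec : (Generator.vec : D.Generator → D.Chain) = Pi.basisFun ℂ D.Generator := by
    funext x
    rw [Generator.vec, Pi.basisFun_apply]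
  rw [filtration, hvec, Module.Basis.mem_span_image]
  simp [Set.subset_def]

theorem exists_setOf_mem_filtration_eq_Iic {z : D.Chain} (hz : z ≠ 0) :
    ∃ x, {a | z ∈ o.filtration t a} = Set.Iic (o.jtGrading t x) := by
  obtain ⟨x, hx, hmin⟩ := Set.exists_min_image (Function.support z) (o.jtGrading t)
    (Set.toFinite _) (Function.support_nonempty_iff.2 hz)
  exact ⟨x, Set.ext fun a => mem_filtration.trans
    ⟨fun h => h x hx, fun h y hy => le_trans h (hmin y hy)⟩⟩

theorem chainGrading_mem_range {z : D.Chain} (hz : z ≠ 0) :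
    o.chainGrading t z ∈ Set.range (o.jtGrading t) := by
  obtain ⟨x, hx⟩ := exists_setOf_mem_filtration_eq_Iic (o := o) (t := t) hz
  exact ⟨x, by rw [chainGrading, hx, csSup_Iic]⟩

theorem le_chainGrading_iff {z : D.Chain} (hz : z ≠ 0) :
    a ≤ o.chainGrading t z ↔ z ∈ o.filtration t a := by
  obtain ⟨x, hx⟩ := exists_setOf_mem_filtration_eq_Iic (o := o) (t := t) hz
  rw [chainGrading, hx, csSup_Iic]
  exact (Set.ext_iff.1 hx a).symm

/-- The filtration of Lee homology by the classes of the cycles in the steps of the filtration of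
the Lee complex. -/
noncomputable def homologyFiltration (o : D.Orientation) (t a : ℝ) : Submodule ℂ D.LeeHomology :=
  ((o.filtration t a).submoduleOf (LinearMap.ker D.leeDiff)).map D.homologyClass

theorem le_homologyGrading_iff {η : D.LeeHomology} (hη : η ≠ 0) :
    a ≤ o.homologyGrading t η ↔ η ∈ o.homologyFiltration t a := by
  have ne_zero {z : LinearMap.ker D.leeDiff} (hz : D.homologyClass z = η) : (z : D.Chain) ≠ 0 := by
    intro h
    obtain rfl : z = 0 := Subtype.ext h
    exact hη (hz.symm.trans (map_zero _))
  set S := {g : ℝ | ∃ z : LinearMap.ker D.leeDiff,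
    D.homologyClass z = η ∧ o.chainGrading t z = g}
  have hfinite : S.Finite := (Set.finite_range (o.jtGrading t)).subset <| by
    rintro _ ⟨z, hz, rfl⟩
    exact chainGrading_mem_range (ne_zero hz)
  constructor
  · intro h
    have hnonempty : S.Nonempty :=
      let ⟨z, hz⟩ := Submodule.mkQ_surjective _ η
      ⟨_, z, hz, rfl⟩
    obtain ⟨z, hz, hmax⟩ := hnonempty.csSup_mem hfinite
    exact ⟨z, (le_chainGrading_iff (ne_zero hz)).1 (h.trans hmax.ge), hz⟩
  · rintro ⟨z, ha, hz⟩
    exact ((le_chainGrading_iff (ne_zero hz)).2 ha).trans (le_csSup hfinite.bddAbove ⟨z, hz, rfl⟩)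

theorem twist_mem_filtration {z : D.Chain} (hz : z ∈ o.filtration t a) :
    D.twist z ∈ o.filtration t a := by
  rw [mem_filtration] at hz ⊢
  exact fun x hx => hz x (right_ne_zero_of_mul (twist_apply z x ▸ hx))

theorem twistHomology_mem_homologyFiltration {η : D.LeeHomology}
    (hη : η ∈ o.homologyFiltration t a) : D.twistHomology η ∈ o.homologyFiltration t a := by
  obtain ⟨z, hz, rfl⟩ := hη
  exact ⟨_, twist_mem_filtration hz, rfl⟩

variable (o t)

theorem homologyGrading_reverse : o.reverse.homologyGrading t = o.homologyGrading t := by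
  have hjt : o.reverse.jtGrading t = o.jtGrading t := by
    funext x
    simp only [jtGrading, jGrading, nPos, nNeg, isPositive_reverse]
  funext η
  simp only [homologyGrading, chainGrading, filtration, hjt]

theorem annularRasmussen_le_homologyGrading_reverse :
    o.annularRasmussen t ≤ o.homologyGrading t o.reverse.canonicalClass := by
  obtain ⟨ζ, hζ, htwist⟩ := o.twistHomology_canonicalClass
  rw [le_homologyGrading_iff o.reverse.canonicalClass_ne_zero, ← Submodule.smul_mem_iff _ hζ,
    ← htwist]
  exact twistHomology_mem_homologyFiltration
    ((le_homologyGrading_iff o.canonicalClass_ne_zero).1 le_rfl)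

theorem annularRasmussen_reverse : o.reverse.annularRasmussen t = o.annularRasmussen t := by
  have hle := o.reverse.annularRasmussen_le_homologyGrading_reverse t
  have hge := o.annularRasmussen_le_homologyGrading_reverse t
  rw [reverse_reverse, homologyGrading_reverse] at hle
  rw [← homologyGrading_reverse] at hge
  exact hle.antisymm hge

theorem annularRasmussen_le_homologyGrading {η : D.LeeHomology}
    (hspan : η ∈ Submodule.span ℂ {o.canonicalClass, o.reverse.canonicalClass}) (hη : η ≠ 0) :
    o.annularRasmussen t ≤ o.homologyGrading t η := by
  rw [le_homologyGrading_iff hη]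
  refine Submodule.span_le.2 ?_ hspan
  rintro _ (rfl | rfl)
  · exact (le_homologyGrading_iff o.canonicalClass_ne_zero).1 le_rfl
  · exact (le_homologyGrading_iff o.reverse.canonicalClass_ne_zero).1
      (o.annularRasmussen_le_homologyGrading_reverse t)

end Orientation

end AnnularDiagram

theorem lemma5p4_general (D : AnnularDiagram) (o : D.Orientation) (t : ℝ) :
    o.canonicalClass ≠ 0 ∧ o.reverse.canonicalClass ≠ 0 ∧
    o.annularRasmussen t = o.reverse.annularRasmussen t ∧
    IsLeast {g : ℝ | ∃ η ∈ Submodule.span ℂ {o.canonicalClass, o.reverse.canonicalClass},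
      η ≠ 0 ∧ o.homologyGrading t η = g} (o.annularRasmussen t) := by
  refine ⟨o.canonicalClass_ne_zero, o.reverse.canonicalClass_ne_zero,
    (o.annularRasmussen_reverse t).symm,
    ⟨o.canonicalClass, Submodule.subset_span (.inl rfl), o.canonicalClass_ne_zero, rfl⟩, ?_⟩
  rintro _ ⟨η, hspan, hη, rfl⟩
  exact o.annularRasmussen_le_homologyGrading t hspan hη

theorem lemma5p4 (D : AnnularDiagram) (o : D.Orientation) (t : ℝ) (ht : t ∈ Set.Icc (0 : ℝ) 2) :
    o.canonicalClass ≠ 0 ∧ o.reverse.canonicalClass ≠ 0 ∧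
    o.annularRasmussen t = o.reverse.annularRasmussen t ∧
    IsLeast {g : ℝ | ∃ η ∈ Submodule.span ℂ {o.canonicalClass, o.reverse.canonicalClass},
      η ≠ 0 ∧ o.homologyGrading t η = g} (o.annularRasmussen t) :=
  lemma5p4_general D o t
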